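/- **Graphs.** A weighted graph $G=(V,m,E,a)$ consists of an at most countable vertex set $V$, masses $m:V\to(0,\infty)$, a locally finite edge set $E\subseteq V\times V$, and weights $a:V\times V\to[0,\infty)$ with $a(v,w)>0$ iff $(v,w)\in E$. It is undirected if $a(v,w)=a(w,v)$ for all $v,w$, and it has bounded degrees if there is $C>0$ with $\sum_w a(v,w)\le C\,m(v)$ and $\sum_w a(w,v)\le C\,m(v)$ for all $v$. On the Hilbert space $\ell^2(G)$ of functions $f:V\to\mathbb C$ with $\sum_v|f(v)|^2m(v)<\infty$ and inner product $\langle f,g\rangle=\sum_v\overline{f(v)}g(v)m(v)$, the Laplacian of a graph with bounded degrees is the bounded operator $$(Lf)(x)=\frac1{m(x)}\Big(\sum_{y}a(x,y)\,f(x)-\sum_{y}a(x,y)f(y)\Big).$$ **Setting.** Let $G=(V,m,E,a)$ be an undirected weighted graph with bounded degrees. Let $\{\hat E_i\}_{i\in I}$ be a countable family of symmetric edge sets $\hat E_i\subseteq E$, with sets $\hat V_i$ of incident vertices, such that $\sum_{v\in\hat V_i}m(v)<\infty$ for every $i$, the sets $\hat V_i$ are pairwise disjoint, and any two vertices of $\hat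 V_i$ are joined by a path of edges in $\hat E_i$. Put $\hat E=\bigcup_i\hat E_i$. For $\beta\in[0,\infty)$ let $G_\beta=(V,m,E,a_\beta)$ be undirected weighted graphs, each with bounded degrees (with a bound that may depend on $\beta$), such that $G_0=G$; for $\tilde\beta>\beta$ one has $a_{\tilde\beta}=a$ on $E\setminus\hat E$ and $a_{\tilde\beta}>a_\beta$ on $\hat E$; and $a_\beta(v,w)\to\infty$ as $\beta\to\infty$ for each $(v,w)\in\hat E$. Let $L_\beta$ be the Laplacian of $G_\beta$ on $\ell^2(G_\beta)=\ell^2(G)$. **Reduced graph.** Let $\underline V$ be the set of connected components of $(V,\hat E)$ (a vertex on no edge of $\hat E$ is a component by itself), $\underline m(C)=\sum_{v\in C}m(v)$, and $\underline a(C,D)=\sum_{v\in C,\,w\in D}a(v,w)$, with edges the pairs $(C,D)$ such that $\underline a(C,D)>0$. Let $\underline L$ be the Laplacian, given by the formula above, of this reduced graph $\underline G$ (which need not be locally finite, but has finite masses and bounded degrees). Define bounded operators $J_\downarrow:\ell^2(G)\to\ell^2(\underline G)$ and $J_\uparrow:\ell^2(\underline G)\to\ell^2(G)$ by $$(J_\downarrow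 f)(C)=\frac{\langle\chi_C,f\rangle}{\underline m(C)},\qquad J_\uparrow g=\sum_{C\in\underline V}g(C)\,\chi_C .$$ **Statement.** For every $t>0$, $e^{-tL_\beta}\to J_\uparrow e^{-t\underline L}J_\downarrow$ strongly as $\beta\to\infty$; that is, for every $f\in\ell^2(G)$, $$\lim_{\beta\to\infty}\big\|e^{-tL_\beta}f-J_\uparrow e^{-t\underline L}J_\downarrow f\big\|_{\ell^2(G)}=0 .$$ -/

import Mathlib

open MeasureTheory Filter Topology
open scoped NNReal ENNReal

/-- The measure on the discrete space `V` giving the point `v` the mass `m v`. -/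
noncomputable def massMeasure {V : Type*} (m : V → ℝ) : @Measure V ⊤ :=
  @Measure.sum V V ⊤ fun v => ENNReal.ofReal (m v) • @Measure.dirac V ⊤ v

/-- The weighted space `ℓ²(V, m)` of functions `f : V → ℂ` with `∑ v, |f v|² m v < ∞`, as the
`L²`-space of the discrete measure with masses `m`; its inner product is
`∑ v, conj (f v) * g v * m v`. Since all masses will be positive, almost everywhere equal functions
are equal. -/
abbrev weightedEll2 {V : Type*} (m : V → ℝ) : Type _ := @Lp V ℂ ⊤ _ 2 (massMeasure m)

theorem massMeasure_lintegral {V : Type*} (m : V → ℝ) (f : V → ℝ≥0∞) :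
    @lintegral V ⊤ (massMeasure m) f = ∑' v, ENNReal.ofReal (m v) * f v := by
  let _ : MeasurableSpace V := ⊤
  unfold massMeasure
  rw [lintegral_sum_measure]
  simp [lintegral_smul_measure]

theorem massMeasure_apply {V : Type*} (m : V → ℝ) (s : Set V) :
    massMeasure m s = ∑' v : s, ENNReal.ofReal (m v) := by
  let _ : MeasurableSpace V := ⊤
  have : massMeasure m s = ∫⁻ v, s.indicator 1 v ∂(massMeasure m) := by
    rw [lintegral_indicator_one MeasurableSpace.measurableSet_top]
  rw [this, massMeasure_lintegral, tsum_subtype s (fun v => ENNReal.ofReal (m v))]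
  congr 1; ext v
  by_cases h : v ∈ s <;> simp [h]

theorem ae_massMeasure {V : Type*} {m : V → ℝ} (hm : ∀ v, 0 < m v) {p : V → Prop} :
    (∀ᵐ v ∂(massMeasure m), p v) ↔ ∀ v, p v := by
  let _ : MeasurableSpace V := ⊤
  refine ⟨fun h v => ?_, fun h => Eventually.of_forall h⟩
  by_contra hv
  have h0 : massMeasure m {v | ¬ p v} = 0 := h
  rw [massMeasure_apply, ENNReal.tsum_eq_zero] at h0
  have := h0 ⟨v, hv⟩
  simp only [ENNReal.ofReal_eq_zero] at this
  exact absurd (hm v) (not_lt.2 this)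

theorem aestronglyMeasurable_discrete {V : Type*} (m : V → ℝ) (f : V → ℂ) :
    @AEStronglyMeasurable V ℂ _ ⊤ ⊤ f (massMeasure m) := by
  let _ : MeasurableSpace V := ⊤
  exact measurable_from_top.aestronglyMeasurable

theorem memLp_massMeasure_iff {V : Type*} {m : V → ℝ} (f : V → ℂ) :
    @MemLp V ℂ ⊤ _ _ f 2 (massMeasure m) ↔
      ∑' v, ENNReal.ofReal (m v) * ‖f v‖ₑ ^ 2 ≠ (∞ : ℝ≥0∞) := by
  let _ : MeasurableSpace V := ⊤
  have : @MemLp V ℂ ⊤ _ _ f 2 (massMeasure m) ↔ eLpNorm f 2 (massMeasure m) < ∞ :=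
   ⟨fun h => h.2, fun h => ⟨aestronglyMeasurable_discrete m f, h⟩⟩
  rw [this, eLpNorm_lt_top_iff_lintegral_rpow_enorm_lt_top (by norm_num) (by norm_num), massMeasure_lintegral]
  simp [lt_top_iff_ne_top]

theorem eLpNorm_massMeasure {V : Type*} {m : V → ℝ} (f : V → ℂ) :
    @eLpNorm V ℂ _ ⊤ f 2 (massMeasure m) ^ 2 =
      ∑' v, ENNReal.ofReal (m v) * ‖f v‖ₑ ^ 2  := by
  let _ : MeasurableSpace V := ⊤
  have h := eLpNorm_nnreal_pow_eq_lintegral (f := f) (μ := massMeasure m) (p := 2) (by norm_num)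
  rw [massMeasure_lintegral] at h
  simpa using h

theorem ennreal_tsum_mul_sq_le {ι : Type*} (w g : ι → ℝ≥0∞) :
    (∑' y, w y * g y) ^ 2 ≤ (∑' y, w y) * ∑' y, w y * g y ^ 2 := by
  let _ : MeasurableSpace ι := ⊤
  have h := ENNReal.lintegral_mul_le_Lp_mul_Lq (Measure.count : Measure ι) (p := 2) (q := 2)
    Real.HolderConjugate.two_two
    (f := fun y => (w y) ^ (1/2 : ℝ)) (g := fun y => (w y) ^ (1/2 : ℝ) * g y)
    measurable_from_top.aemeasurable measurable_from_top.aemeasurable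
  simp only [lintegral_count, Pi.mul_apply] at h
  have e1 : ∀ y, (w y) ^ (1/2 : ℝ) * ((w y) ^ (1/2 : ℝ) * g y) = w y * g y := by
    intro y
    rw [← mul_assoc, ← ENNReal.rpow_add_of_nonneg _ _ (by norm_num) (by norm_num)]; norm_num
  have e2 : ∀ y, ((w y) ^ (1/2 : ℝ)) ^ (2:ℝ) = w y := by
    intro y; rw [← ENNReal.rpow_mul]; norm_num
  have e3 : ∀ y, ((w y) ^ (1/2 : ℝ) * g y) ^ (2:ℝ) = w y * g y ^ 2 := by
    intro y
    rw [ENNReal.mul_rpow_of_nonneg _ _ (by norm_num), e2]; norm_cast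
  simp only [e1, e2, e3] at h
  calc _ ≤ _ := pow_le_pow_left' h 2
    _ = _ := by
      rw [mul_pow, ← ENNReal.rpow_natCast, ← ENNReal.rpow_natCast, ← ENNReal.rpow_mul, ← ENNReal.rpow_mul]; norm_num

/-- A weighted (possibly directed) graph on the vertex set `V`: positive vertex masses `m`, a set of
edges `E` and a nonnegative edge weight function `a` whose support is `E`. Countability of `V` and
local finiteness of `E` are imposed separately. -/
structure WeightedGraph (V : Type*) where
  m : V → ℝ
  m_pos : ∀ v, 0 < m v
  E : Set (V × V)
  a : V → V → ℝ
  a_nonneg : ∀ v w, 0 ≤ a v w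
  a_pos_iff : ∀ v w, 0 < a v w ↔ (v, w) ∈ E

namespace WeightedGraph

variable {V : Type*}

/-- The graph with all edges reversed. -/
def transpose (G : WeightedGraph V) : WeightedGraph V where
  m := G.m
  m_pos := G.m_pos
  E := {p | (p.2, p.1) ∈ G.E}
  a v w := G.a w v
  a_nonneg v w := G.a_nonneg w v
  a_pos_iff v w := G.a_pos_iff w v

/-- A graph is undirected if it equals its transpose. -/
def IsUndirected (G : WeightedGraph V) : Prop := G = G.transpose

/-- Every vertex lies on only finitely many edges. -/
def LocallyFinite (G : WeightedGraph V) : Prop :=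
  ∀ v, {w | (v, w) ∈ G.E}.Finite ∧ {w | (w, v) ∈ G.E}.Finite

/-- The in-degree `d⁻(v) = ∑ i, a(v, i)`. -/
noncomputable def inDegree (G : WeightedGraph V) (v : V) : ℝ := ∑' i, G.a v i

/-- The out-degree `d⁺(v) = ∑ j, a(j, v)`. -/
noncomputable def outDegree (G : WeightedGraph V) (v : V) : ℝ := ∑' j, G.a j v

/-- In- and out-degrees are finite and bounded by `C` times the mass. -/
def BoundedDegreesBy (G : WeightedGraph V) (C : ℝ) : Prop :=
  ∀ v, (Summable (fun i => G.a v i) ∧ G.inDegree v ≤ C * G.m v) ∧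
    (Summable (fun j => G.a j v) ∧ G.outDegree v ≤ C * G.m v)

/-- In- and out-degrees are uniformly bounded relative to the vertex mass. -/
def BoundedDegrees (G : WeightedGraph V) : Prop := ∃ C > 0, G.BoundedDegreesBy C

/-- The Hilbert space `ℓ²(G)`. -/
abbrev ell2 (G : WeightedGraph V) : Type _ := weightedEll2 G.m

theorem ext_ell2 {G : WeightedGraph V} {f g : G.ell2} (h : ∀ v, f v = g v) : f = g :=
  Lp.ext (Eventually.of_forall h)

theorem toLp_apply (G : WeightedGraph V) {f : V → ℂ}
    (hf : @MemLp V ℂ ⊤ _ _ f 2 (massMeasure G.m)) (v : V) : (hf.toLp f : G.ell2) v = f v :=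
  (ae_massMeasure G.m_pos).1 hf.coeFn_toLp v

theorem add_apply (G : WeightedGraph V) (f g : G.ell2) (v : V) : (f + g) v = f v + g v :=
  (ae_massMeasure G.m_pos).1 (Lp.coeFn_add f g) v

theorem smul_apply (G : WeightedGraph V) (c : ℂ) (f : G.ell2) (v : V) : (c • f) v = c * f v :=
  (ae_massMeasure G.m_pos).1 (Lp.coeFn_smul c f) v

/-- The pointwise action of the (in-degree) Laplacian,
`(L f)(x) = (d⁻(x) f(x) - ∑ y, a(x, y) f(y)) / m(x)`. -/
noncomputable def inLaplacianFun (G : WeightedGraph V) (f : V → ℂ) (x : V) : ℂ :=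
  1 / (G.m x : ℂ) * ((G.inDegree x : ℂ) * f x - ∑' y, (G.a x y : ℂ) * f y)

theorem row_le (G : WeightedGraph V) {C : ℝ} (hC : 0 < C) (h : G.BoundedDegreesBy C)
    (x : V) : ∑' y, ENNReal.ofReal (G.a x y) ≤ ENNReal.ofReal C * ENNReal.ofReal (G.m x) := by
  rw [← ENNReal.ofReal_tsum_of_nonneg (G.a_nonneg x) (h x).1.1, ← ENNReal.ofReal_mul hC.le]
  exact ENNReal.ofReal_le_ofReal (h x).1.2

theorem col_le (G : WeightedGraph V) {C : ℝ} (hC : 0 < C) (h : G.BoundedDegreesBy C)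
    (y : V) : ∑' x, ENNReal.ofReal (G.a x y) ≤ ENNReal.ofReal C * ENNReal.ofReal (G.m y) := by
  rw [← ENNReal.ofReal_tsum_of_nonneg (fun x => G.a_nonneg x y) (h y).2.1, ← ENNReal.ofReal_mul hC.le]
  exact ENNReal.ofReal_le_ofReal (h y).2.2

theorem double_le (G : WeightedGraph V) {C : ℝ} (hC : 0 < C) (h : G.BoundedDegreesBy C)
    (g : V → ℝ≥0∞) :
    ∑' x, ∑' y, ENNReal.ofReal (G.a x y) * g y ≤
      ENNReal.ofReal C * ∑' y, ENNReal.ofReal (G.m y) * g y := by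
  rw [ENNReal.tsum_comm, ← ENNReal.tsum_mul_left]
  refine ENNReal.tsum_le_tsum fun y => ?_
  rw [ENNReal.tsum_mul_right, ← mul_assoc]
  gcongr
  exact G.col_le hC h y

theorem adj_sq_le (G : WeightedGraph V) {C : ℝ} (hC : 0 < C) (h : G.BoundedDegreesBy C)
    (f : V → ℂ) (x : V) :
    (∑' y, ENNReal.ofReal (G.a x y) * ‖f y‖ₑ) ^ 2 ≤
      ENNReal.ofReal C * ENNReal.ofReal (G.m x) * ∑' y, ENNReal.ofReal (G.a x y) * ‖f y‖ₑ ^ 2 :=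
  (ennreal_tsum_mul_sq_le _ _).trans (by gcongr; exact G.row_le hC h x)

theorem summable_adj (G : WeightedGraph V) {C : ℝ} (hC : 0 < C) (h : G.BoundedDegreesBy C)
    (f : G.ell2) (x : V) : Summable fun y => (G.a x y : ℂ) * f y := by
  have hf := (memLp_massMeasure_iff (m := G.m) f).1 (Lp.memLp f)
  have h1 : ∑' y, ENNReal.ofReal (G.a x y) * ‖f y‖ₑ ^ 2 ≠ (∞ : ℝ≥0∞) := by
    refine ne_top_of_le_ne_top ?_ ((ENNReal.le_tsum x).trans (G.double_le hC h fun y => ‖f y‖ₑ ^ 2))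
    exact ENNReal.mul_ne_top ENNReal.ofReal_ne_top hf
  have h2 : ∑' y, ENNReal.ofReal (G.a x y) * ‖f y‖ₑ ≠ (∞ : ℝ≥0∞) := by
    intro h3
    have := G.adj_sq_le hC h f x
    rw [h3] at this
    exact ENNReal.mul_ne_top (ENNReal.mul_ne_top ENNReal.ofReal_ne_top ENNReal.ofReal_ne_top) h1
      (top_unique (by simpa using this))
  refine Summable.of_norm ?_
  have := ENNReal.summable_toReal h2
  refine this.congr fun y => ?_
  simp [ENNReal.toReal_mul, ENNReal.toReal_ofReal (G.a_nonneg x y), abs_of_nonneg (G.a_nonneg x y)]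

theorem enorm_adj_le (G : WeightedGraph V) (f : V → ℂ) (x : V) :
    ‖1 / (G.m x : ℂ) * ∑' y, (G.a x y : ℂ) * f y‖ₑ ≤
      (ENNReal.ofReal (G.m x))⁻¹ * ∑' y, ENNReal.ofReal (G.a x y) * ‖f y‖ₑ := by
  rw [enorm_mul]
  have e1 : ‖1 / (G.m x : ℂ)‖ₑ = (ENNReal.ofReal (G.m x))⁻¹ := by
    rw [← ofReal_norm, ← ENNReal.ofReal_inv_of_pos (G.m_pos x)]
    simp [abs_of_pos (G.m_pos x)]
  rw [e1]
  gcongr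
  refine (enorm_tsum_le_tsum_enorm).trans (le_of_eq ?_)
  refine tsum_congr fun y => ?_
  rw [enorm_mul]
  congr 1
  rw [← ofReal_norm]
  simp [abs_of_nonneg (G.a_nonneg x y)]

theorem eLpNorm_adj_le (G : WeightedGraph V) {C : ℝ} (hC : 0 < C) (h : G.BoundedDegreesBy C)
    (f : V → ℂ) :
    @eLpNorm V ℂ _ ⊤ (fun x => 1 / (G.m x : ℂ) * ∑' y, (G.a x y : ℂ) * f y) 2 (massMeasure G.m) ≤
      ENNReal.ofReal C * @eLpNorm V ℂ _ ⊤ f 2 (massMeasure G.m) := by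
  rw [← ENNReal.pow_le_pow_left_iff (n := 2) (by norm_num), mul_pow, eLpNorm_massMeasure, eLpNorm_massMeasure]
  calc _ ≤ ∑' x, ENNReal.ofReal C * ∑' y, ENNReal.ofReal (G.a x y) * ‖f y‖ₑ ^ 2 := by
        refine ENNReal.tsum_le_tsum fun x => ?_
        set M := ENNReal.ofReal (G.m x) with hM
        have hM0 : M ≠ 0 := by simpa [hM] using G.m_pos x
        have hMt : M ≠ ∞ := ENNReal.ofReal_ne_top
        calc _ ≤ M * (M⁻¹ * ∑' y, ENNReal.ofReal (G.a x y) * ‖f y‖ₑ) ^ 2 := by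
              gcongr; exact G.enorm_adj_le f x
          _ ≤ M * (M⁻¹ ^ 2 * (ENNReal.ofReal C * M * ∑' y, ENNReal.ofReal (G.a x y) * ‖f y‖ₑ ^ 2)) := by
              rw [mul_pow]; gcongr; exact G.adj_sq_le hC h f x
          _ = (M * M⁻¹) * (M * M⁻¹) * (ENNReal.ofReal C * ∑' y, ENNReal.ofReal (G.a x y) * ‖f y‖ₑ ^ 2) := by ring
          _ = _ := by rw [ENNReal.mul_inv_cancel hM0 hMt]; ring
    _ = ENNReal.ofReal C * ∑' x, ∑' y, ENNReal.ofReal (G.a x y) * ‖f y‖ₑ ^ 2 := ENNReal.tsum_mul_left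
    _ ≤ ENNReal.ofReal C * (ENNReal.ofReal C * ∑' y, ENNReal.ofReal (G.m y) * ‖f y‖ₑ ^ 2) := by
        gcongr; exact G.double_le hC h _
    _ = _ := by ring

theorem eLpNorm_diag_le (G : WeightedGraph V) {C : ℝ} (h : G.BoundedDegreesBy C)
    (f : V → ℂ) :
    @eLpNorm V ℂ _ ⊤ (fun x => 1 / (G.m x : ℂ) * ((G.inDegree x : ℂ) * f x)) 2 (massMeasure G.m) ≤
      ENNReal.ofReal C * @eLpNorm V ℂ _ ⊤ f 2 (massMeasure G.m) := by
  let _ : MeasurableSpace V := ⊤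
  refine eLpNorm_le_mul_eLpNorm_of_ae_le_mul (Eventually.of_forall fun x => ?_) 2
  have h0 : 0 ≤ G.inDegree x := tsum_nonneg (G.a_nonneg x)
  rw [norm_mul, norm_mul, ← mul_assoc]
  gcongr
  simp only [one_div, norm_inv, Complex.norm_real, Real.norm_eq_abs, abs_of_pos (G.m_pos x),
    abs_of_nonneg h0]
  rw [inv_mul_le_iff₀ (G.m_pos x), mul_comm]
  exact (h x).1.2

theorem eLpNorm_inLaplacianFun_le (G : WeightedGraph V) {C : ℝ} (hC : 0 < C) (h : G.BoundedDegreesBy C)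
    (f : V → ℂ) :
    @eLpNorm V ℂ _ ⊤ (G.inLaplacianFun f) 2 (massMeasure G.m) ≤
      ENNReal.ofReal (2 * C) * @eLpNorm V ℂ _ ⊤ f 2 (massMeasure G.m) := by
  let _ : MeasurableSpace V := ⊤
  have e : G.inLaplacianFun f = (fun x => 1 / (G.m x : ℂ) * ((G.inDegree x : ℂ) * f x)) -
      (fun x => 1 / (G.m x : ℂ) * ∑' y, (G.a x y : ℂ) * f y) := by
    ext x; simp [inLaplacianFun, mul_sub]
  rw [e]
  refine (eLpNorm_sub_le (aestronglyMeasurable_discrete _ _) (aestronglyMeasurable_discrete _ _) (by norm_num)).trans ?_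
  refine (add_le_add (G.eLpNorm_diag_le h f) (G.eLpNorm_adj_le hC h f)).trans (le_of_eq ?_)
  rw [ENNReal.ofReal_mul (by norm_num)]
  simp; ring

theorem memLp_inLaplacianFun (G : WeightedGraph V) {C : ℝ} (hC : 0 < C) (h : G.BoundedDegreesBy C)
    (f : G.ell2) :
    @MemLp V ℂ ⊤ _ _ (G.inLaplacianFun f) 2 (massMeasure G.m) :=
  ⟨aestronglyMeasurable_discrete _ _, (G.eLpNorm_inLaplacianFun_le hC h f).trans_lt
    (ENNReal.mul_lt_top ENNReal.ofReal_lt_top (Lp.memLp f).2)⟩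


theorem BoundedDegrees.memLp {G : WeightedGraph V} (hG : G.BoundedDegrees) (f : G.ell2) :
    @MemLp V ℂ ⊤ _ _ (G.inLaplacianFun f) 2 (massMeasure G.m) := by
  obtain ⟨C, hC, h⟩ := hG
  exact G.memLp_inLaplacianFun hC h f

theorem BoundedDegrees.summable {G : WeightedGraph V} (hG : G.BoundedDegrees) (f : G.ell2) (x : V) :
    Summable fun y => (G.a x y : ℂ) * f y := by
  obtain ⟨C, hC, h⟩ := hG
  exact G.summable_adj hC h f x

/-- The graph Laplacian as a bounded operator on `ℓ²(G)`, for a graph with bounded degrees. (For an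
undirected graph the in- and out-degree Laplacians coincide.) -/
noncomputable def laplacian (G : WeightedGraph V) (hG : G.BoundedDegrees) : G.ell2 →L[ℂ] G.ell2 :=
  LinearMap.mkContinuousOfExistsBound
    { toFun := fun f => (hG.memLp f).toLp (G.inLaplacianFun f)
      map_add' := fun f g => by
        refine ext_ell2 fun x => ?_
        simp only [add_apply, toLp_apply, inLaplacianFun, mul_add]
        rw [(hG.summable f x).tsum_add (hG.summable g x)]
        ring
      map_smul' := fun c f => by
        refine ext_ell2 fun x => ?_
        simp only [smul_apply, toLp_apply, inLaplacianFun, RingHom.id_apply]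
        rw [tsum_congr fun y => mul_left_comm (G.a x y : ℂ) c (f y), tsum_mul_left]
        ring }
    (by
      obtain ⟨C, hC, h⟩ := id hG
      refine ⟨2 * C, fun f => ?_⟩
      have h1 := G.eLpNorm_inLaplacianFun_le hC h f
      change ‖(hG.memLp f).toLp (G.inLaplacianFun f)‖ ≤ _
      rw [Lp.norm_toLp, Lp.norm_def]
      refine (ENNReal.toReal_mono (ENNReal.mul_ne_top ENNReal.ofReal_ne_top (Lp.eLpNorm_ne_top f)) h1).trans (le_of_eq ?_)
      rw [ENNReal.toReal_mul, ENNReal.toReal_ofReal (by positivity)])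

theorem laplacian_apply (G : WeightedGraph V) (hG : G.BoundedDegrees) (f : G.ell2) (x : V) :
    G.laplacian hG f x = 1 / (G.m x : ℂ) * ((G.inDegree x : ℂ) * f x - ∑' y, (G.a x y : ℂ) * f y) :=
  toLp_apply G (hG.memLp f) x

/-- The heat semigroup `exp (-t L)` on `ℓ²(G)`. -/
noncomputable def heatSemigroup (G : WeightedGraph V) (hG : G.BoundedDegrees) (t : ℝ) :
    G.ell2 →L[ℂ] G.ell2 :=
  NormedSpace.exp (-(t : ℂ) • G.laplacian hG)

/-- `v` sees `w` along edges in `F`: there is a (possibly empty) path of edges in `F`. -/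
def Sees (F : Set (V × V)) : V → V → Prop := Relation.ReflTransGen fun v w => (v, w) ∈ F

/-- The vertices on the edges of a symmetric edge set `F`. -/
def nodeSet (F : Set (V × V)) : Set V := {v | ∃ w, (v, w) ∈ F}

/-- A collection of undirected clusters: a family of symmetric edge sets contained in `G.E`, each of
finite total vertex mass, pairwise vertex-disjoint, and each connected. -/
structure Clusters (G : WeightedGraph V) (I : Type*) where
  edges : I → Set (V × V)
  edges_subset : ∀ i, edges i ⊆ G.E
  edges_symm : ∀ i v w, (v, w) ∈ edges i → (w, v) ∈ edges i
  mass_finite : ∀ i, Summable fun v : nodeSet (edges i) => G.m v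
  node_disjoint : ∀ i j, i ≠ j → Disjoint (nodeSet (edges i)) (nodeSet (edges j))
  connected : ∀ i, ∀ v ∈ nodeSet (edges i), ∀ w ∈ nodeSet (edges i), Sees (edges i) v w

/-- Aggregation of edge weights along `q : V → W`: `∑ a(v, w)` over all `v` in the fibre of `C` and
`w` in the fibre of `D`. -/
noncomputable def aggregate {W : Type*} (q : V → W) (a : V → V → ℝ) (C D : W) : ℝ :=
  ∑' p : {v // q v = C} × {w // q w = D}, a p.1 p.2

theorem aggregate_bound {W : Type*} (q : V → W) (a : V → V → ℝ) (ha : ∀ v w, 0 ≤ a v w)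
    (m : V → ℝ) (hm : ∀ v, 0 < m v) {c : ℝ} (hc : 0 < c)
    (hs : ∀ v, Summable (a v)) (hb : ∀ v, ∑' w, a v w ≤ c * m v) (C : W)
    (hC : Summable fun v : {v // q v = C} => m v) :
    Summable (fun D => aggregate q a C D) ∧
      ∑' D, aggregate q a C D ≤ c * ∑' v : {v // q v = C}, m v := by
  have key : ∑' D, ∑' p : {v // q v = C} × {w // q w = D}, ENNReal.ofReal (a p.1 p.2) ≤
      ENNReal.ofReal (c * ∑' v : {v // q v = C}, m v) := by
    calc _ = ∑' v : {v // q v = C}, ∑' w, ENNReal.ofReal (a v w) := by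
          simp_rw [ENNReal.tsum_prod']
          rw [ENNReal.tsum_comm]
          refine tsum_congr fun v => ?_
          rw [← ENNReal.tsum_sigma' (fun x : (D : W) × {w // q w = D} => ENNReal.ofReal (a v x.2))]
          exact (Equiv.sigmaFiberEquiv q).tsum_eq fun w => ENNReal.ofReal (a v w)
      _ ≤ ∑' v : {v // q v = C}, ENNReal.ofReal (c * m v) := by
          refine ENNReal.tsum_le_tsum fun v => ?_
          rw [← ENNReal.ofReal_tsum_of_nonneg (ha v) (hs v)]
          exact ENNReal.ofReal_le_ofReal (hb v)
      _ = _ := by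
          rw [← tsum_mul_left]
          exact (ENNReal.ofReal_tsum_of_nonneg (f := fun v : {v // q v = C} => c * m v)
            (fun v => (mul_pos hc (hm v)).le) (hC.mul_left c)).symm
  have fin := ne_top_of_le_ne_top ENNReal.ofReal_ne_top key
  have e : ∀ D, aggregate q a C D =
      (∑' p : {v // q v = C} × {w // q w = D}, ENNReal.ofReal (a p.1 p.2)).toReal := by
    intro D
    rw [ENNReal.tsum_toReal_eq fun _ => ENNReal.ofReal_ne_top]
    exact tsum_congr fun p => (ENNReal.toReal_ofReal (ha _ _)).symm
  simp_rw [e]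
  refine ⟨ENNReal.summable_toReal fin, ?_⟩
  rw [← ENNReal.tsum_toReal_eq fun D => ne_top_of_le_ne_top fin (ENNReal.le_tsum D)]
  refine ENNReal.toReal_le_of_le_ofReal (mul_nonneg hc.le (tsum_nonneg fun v => (hm v).le)) key

theorem aggregate_swap {W : Type*} (q : V → W) (a : V → V → ℝ) (C D : W) :
    aggregate q a C D = aggregate q (fun v w => a w v) D C :=
  (Equiv.prodComm _ _).tsum_eq fun p : {v // q v = D} × {w // q w = C} => a p.2 p.1

namespace Clusters

variable {G : WeightedGraph V} {I : Type*}

/-- The union of all cluster edge sets. -/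
def totalEdges (K : G.Clusters I) : Set (V × V) := ⋃ i, K.edges i

theorem totalEdges_symm (K : G.Clusters I) {v w : V} (h : (v, w) ∈ K.totalEdges) :
    (w, v) ∈ K.totalEdges := by
  obtain ⟨i, hi⟩ := Set.mem_iUnion.1 h
  exact Set.mem_iUnion.2 ⟨i, K.edges_symm i v w hi⟩

/-- Two vertices are equivalent if they are joined by a path of cluster edges. -/
def setoid (K : G.Clusters I) : Setoid V where
  r := Sees K.totalEdges
  iseqv :=
    { refl := fun _ => Relation.ReflTransGen.refl
      symm := fun h => by
        induction h with
        | refl => exact Relation.ReflTransGen.refl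
        | tail _ hbc ih => exact Relation.ReflTransGen.head (K.totalEdges_symm hbc) ih
      trans := Relation.ReflTransGen.trans }

/-- The connected components of `V` with respect to the cluster edges (a vertex on no cluster edge is
a component by itself). -/
abbrev Component (K : G.Clusters I) : Type _ := Quotient K.setoid

/-- The component of a vertex. -/
def component (K : G.Clusters I) (v : V) : K.Component := Quotient.mk K.setoid v

theorem summable_component (K : G.Clusters I) (C : K.Component) :
    Summable fun v : {v // K.component v = C} => G.m v := by
  induction C using Quotient.inductionOn with | _ x =>
  by_cases hx : ∃ i, x ∈ nodeSet (K.edges i)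
  · obtain ⟨i, hi⟩ := hx
    have sub : ∀ y, Sees K.totalEdges x y → y ∈ nodeSet (K.edges i) := by
      intro y hy
      induction hy with
      | refl => exact hi
      | @tail b c _ hbc ih =>
        obtain ⟨j, hj⟩ := Set.mem_iUnion.1 hbc
        have hij : i = j := by
          by_contra hne
          exact Set.disjoint_left.1 (K.node_disjoint i j hne) ih ⟨c, hj⟩
        subst hij
        exact ⟨b, K.edges_symm i b c hj⟩
    have sub' : {v | K.component v = Quotient.mk K.setoid x} ⊆ nodeSet (K.edges i) :=
      fun y hy => sub y (K.setoid.symm (Quotient.exact hy))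
    exact (K.mass_finite i).comp_injective (Set.inclusion_injective sub')
  · have sub : ∀ y, Sees K.totalEdges x y → y = x := by
      intro y hy
      rcases Relation.ReflTransGen.cases_head hy with h | ⟨c, hc, _⟩
      · exact h.symm
      · obtain ⟨j, hj⟩ := Set.mem_iUnion.1 hc
        exact absurd ⟨j, c, hj⟩ hx
    have : Subsingleton {v // K.component v = Quotient.mk K.setoid x} :=
      ⟨fun y z => Subtype.ext <| (sub y (K.setoid.symm (Quotient.exact y.2))).trans
        (sub z (K.setoid.symm (Quotient.exact z.2))).symm⟩
    have := Finite.of_subsingleton (α := {v // K.component v = Quotient.mk K.setoid x})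
    exact Summable.of_finite

/-- The reduced graph: its vertices are the components, its masses and edge weights are the sums of the
original ones, its edges are the support of the weights. -/
noncomputable def reduced (K : G.Clusters I) : WeightedGraph K.Component where
  m C := ∑' v : {v // K.component v = C}, G.m v
  m_pos C := by
    obtain ⟨x, hx⟩ := Quotient.exists_rep C
    exact (K.summable_component C).tsum_pos (fun v => (G.m_pos v).le) ⟨x, hx⟩ (G.m_pos x)
  E := {p | 0 < aggregate K.component G.a p.1 p.2}
  a := aggregate K.component G.a
  a_nonneg C D := tsum_nonneg fun p => G.a_nonneg _ _
  a_pos_iff C D := Iff.rfl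

theorem reduced_boundedDegrees (K : G.Clusters I) (hG : G.BoundedDegrees) :
    K.reduced.BoundedDegrees := by
  obtain ⟨c, hc, h⟩ := hG
  refine ⟨c, hc, fun C => ⟨?_, ?_⟩⟩
  · exact aggregate_bound K.component G.a G.a_nonneg G.m G.m_pos hc (fun v => (h v).1.1)
      (fun v => (h v).1.2) C (K.summable_component C)
  · have := aggregate_bound K.component (fun v w => G.a w v) (fun v w => G.a_nonneg w v) G.m
      G.m_pos hc (fun v => (h v).2.1) (fun v => (h v).2.2) C (K.summable_component C)
    simp_rw [← aggregate_swap] at this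
    exact this

theorem measurePreserving (K : G.Clusters I) :
    @MeasurePreserving V K.Component ⊤ ⊤ K.component (massMeasure G.m)
      (massMeasure K.reduced.m) := by
  let _ : MeasurableSpace V := ⊤
  let _ : MeasurableSpace K.Component := ⊤
  refine ⟨measurable_from_top, Measure.ext fun s hs => ?_⟩
  rw [Measure.map_apply measurable_from_top hs, ← lintegral_indicator_one hs,
    ← lintegral_indicator_one MeasurableSpace.measurableSet_top, massMeasure_lintegral,
    massMeasure_lintegral, ← (Equiv.sigmaFiberEquiv K.component).tsum_eq, ENNReal.tsum_sigma']
  refine tsum_congr fun C => ?_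
  change _ = ENNReal.ofReal (∑' v : {v // K.component v = C}, G.m v) * _
  rw [ENNReal.ofReal_tsum_of_nonneg (f := fun v : {v // K.component v = C} => G.m v)
    (fun v => (G.m_pos v).le) (K.summable_component C), ← ENNReal.tsum_mul_right]
  refine tsum_congr fun v => ?_
  have : K.component v = C := v.2
  have hv : (v : V) ∈ K.component ⁻¹' s ↔ C ∈ s := by rw [Set.mem_preimage, this]
  by_cases h : C ∈ s <;> simp [Equiv.sigmaFiberEquiv, Set.indicator, hv, h]

theorem massMeasure_component (K : G.Clusters I) (C : K.Component) :
    massMeasure G.m {v | K.component v = C} = ENNReal.ofReal (K.reduced.m C) := by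
  rw [massMeasure_apply]
  exact (ENNReal.ofReal_tsum_of_nonneg (f := fun v : {v // K.component v = C} => G.m v)
    (fun v => (G.m_pos v).le) (K.summable_component C)).symm

/-- The characteristic function of a component, as an element of `ℓ²(G)`. -/
noncomputable def indicator (K : G.Clusters I) (C : K.Component) : G.ell2 :=
  indicatorConstLp 2 (MeasurableSpace.measurableSet_top (s := {v | K.component v = C}))
    (by rw [K.massMeasure_component C]; exact ENNReal.ofReal_ne_top) 1

open Classical in
theorem indicator_apply (K : G.Clusters I) (C : K.Component) (v : V) :
    K.indicator C v = if K.component v = C then 1 else 0 := by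
  have := (ae_massMeasure G.m_pos).1 (indicatorConstLp_coeFn (p := 2)
    (hs := MeasurableSpace.measurableSet_top (s := {v | K.component v = C}))
    (hμs := by rw [K.massMeasure_component C]; exact ENNReal.ofReal_ne_top) (c := (1 : ℂ))) v
  refine this.trans ?_
  by_cases h : K.component v = C <;> simp [Set.indicator, h]

/-- The interpolation operator `J↑ g = ∑ C, g(C) χ_C`, that is, `(J↑ g)(v) = g([v])`. -/
noncomputable def interpolation (K : G.Clusters I) : K.reduced.ell2 →L[ℂ] G.ell2 :=
  letI : MeasurableSpace V := ⊤
  letI : MeasurableSpace K.Component := ⊤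
  (Lp.compMeasurePreservingₗᵢ ℂ K.component K.measurePreserving).toContinuousLinearMap

theorem interpolation_apply (K : G.Clusters I) (g : K.reduced.ell2) (v : V) :
    K.interpolation g v = g (K.component v) :=
  letI : MeasurableSpace V := ⊤
  letI : MeasurableSpace K.Component := ⊤
  (ae_massMeasure G.m_pos).1 (Lp.coeFn_compMeasurePreserving g K.measurePreserving) v

theorem adjoint_apply (K : G.Clusters I) (f : G.ell2) (C : K.Component) :
    ContinuousLinearMap.adjoint K.interpolation f C =
      inner ℂ (K.indicator C) f / (K.reduced.m C : ℂ) := by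
  let _ : MeasurableSpace K.Component := ⊤
  have hμ : massMeasure K.reduced.m {C} = ENNReal.ofReal (K.reduced.m C) := by
    rw [massMeasure_apply, tsum_subtype _ (fun v => ENNReal.ofReal (K.reduced.m v)),
      tsum_eq_single C (fun D hD => by simp [hD])]
    simp
  let δ : K.reduced.ell2 := indicatorConstLp 2 (MeasurableSpace.measurableSet_top (s := {C}))
    (by rw [hμ]; exact ENNReal.ofReal_ne_top) 1
  have hδ : K.interpolation δ = K.indicator C := by
    refine ext_ell2 fun v => ?_
    rw [interpolation_apply, indicator_apply]
    have := (ae_massMeasure K.reduced.m_pos).1 (indicatorConstLp_coeFn (p := 2)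
      (hs := MeasurableSpace.measurableSet_top (s := {C}))
      (hμs := by rw [hμ]; exact ENNReal.ofReal_ne_top) (c := (1 : ℂ))) (K.component v)
    refine this.trans ?_
    by_cases h : K.component v = C <;> simp [Set.indicator, h]
  rw [← hδ, ← ContinuousLinearMap.adjoint_inner_right, L2.inner_indicatorConstLp_one,
    integral_singleton]
  have h0 : (K.reduced.m C : ℂ) ≠ 0 := by exact_mod_cast (K.reduced.m_pos C).ne'
  rw [Measure.real, hμ, ENNReal.toReal_ofReal (K.reduced.m_pos C).le, Complex.real_smul]
  field_simp

theorem memLp_projection (K : G.Clusters I) (f : G.ell2) :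
    @MemLp K.Component ℂ ⊤ _ _ (fun C => inner ℂ (K.indicator C) f / (K.reduced.m C : ℂ)) 2
      (massMeasure K.reduced.m) := by
  have := Lp.memLp (ContinuousLinearMap.adjoint K.interpolation f)
  rwa [funext (K.adjoint_apply f)] at this

/-- The projection operator `(J↓ f)(C) = ⟨χ_C, f⟩ / m(C)`. -/
noncomputable def projection (K : G.Clusters I) : G.ell2 →L[ℂ] K.reduced.ell2 :=
  LinearMap.mkContinuousOfExistsBound
    { toFun := fun f => (K.memLp_projection f).toLp
        fun C => inner ℂ (K.indicator C) f / (K.reduced.m C : ℂ)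
      map_add' := fun f g => by
        refine ext_ell2 fun C => ?_
        rw [add_apply, toLp_apply, toLp_apply, toLp_apply, inner_add_right, add_div]
      map_smul' := fun c f => by
        refine ext_ell2 fun C => ?_
        rw [RingHom.id_apply, smul_apply, toLp_apply, toLp_apply, inner_smul_right, mul_div_assoc] }
    (by
      refine ⟨‖ContinuousLinearMap.adjoint K.interpolation‖, fun f => ?_⟩
      refine le_trans (le_of_eq (congrArg norm ?_))
        ((ContinuousLinearMap.adjoint K.interpolation).le_opNorm f)
      refine ext_ell2 fun C => ?_
      rw [adjoint_apply]
      exact toLp_apply K.reduced (K.memLp_projection f) C)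

theorem projection_apply (K : G.Clusters I) (f : G.ell2) (C : K.Component) :
    K.projection f C = inner ℂ (K.indicator C) f / (K.reduced.m C : ℂ) :=
  toLp_apply K.reduced (K.memLp_projection f) C

/-- A family of edge weights `a β`, `β ∈ [0, ∞)`, on the edges of `G`, starting at the weights of `G`,
constant on all edges outside the clusters, and on each cluster edge strictly increasing to infinity.
-/
structure ConnectivityFamily (K : G.Clusters I) where
  a : ℝ≥0 → V → V → ℝ
  a_nonneg : ∀ β v w, 0 ≤ a β v w
  a_pos_iff : ∀ β v w, 0 < a β v w ↔ (v, w) ∈ G.E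
  a_zero : ∀ v w, a 0 v w = G.a v w
  a_background : ∀ β β' : ℝ≥0, β < β' → ∀ v w, (v, w) ∈ G.E \ K.totalEdges → a β' v w = G.a v w
  a_cluster : ∀ β β' : ℝ≥0, β < β' → ∀ v w, (v, w) ∈ K.totalEdges → a β v w < a β' v w
  a_tendsto : ∀ v w, (v, w) ∈ K.totalEdges → Tendsto (fun β => a β v w) atTop atTop

/-- The graph `G_β` with the masses and edges of `G` and the weights `a β`. -/
abbrev ConnectivityFamily.graph {K : G.Clusters I} (F : K.ConnectivityFamily) (β : ℝ≥0) :
    WeightedGraph V where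
  m := G.m
  m_pos := G.m_pos
  E := G.E
  a := F.a β
  a_nonneg := F.a_nonneg β
  a_pos_iff := F.a_pos_iff β

end Clusters
end WeightedGraph

open scoped ComplexConjugate

/-! Write `J` for the interpolation operator. It is an isometry whose adjoint is the projection, and
its range consists of the functions that are constant on components. Since differences across
cluster edges vanish on this range, `L_β J = L J` does not depend on `β`, and the compression `J† L
J` is the reduced Laplacian. In the other directions the Dirichlet form blows up: for a cluster edge
`(v, w)` it dominates `a_β(v, w) / 2 * |h v - h w|²`.

The convergence is a Hilbert space statement, `tendsto_exp_neg_smul_of_blowup`. Suppose `c_i |⟨d,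
h⟩|² ≤ ⟨A_i h, h⟩` with `c_i → ∞`. Taking `h = e^{-2sA_i} d` gives `c_i ‖e^{-sA_i} d‖⁴ ≤ ‖d‖² /
(2s)`, so `e^{-sA_i} d → 0`. By contractivity this extends to the closed span of all such `d`, which
contains `ker J†` (`tendsto_exp_neg_smul_zero`).

Split `f` into `J J† f` and a remainder in `ker J†`, which is thus killed in the limit. On the range
of `J`, Duhamel's formula `exp_neg_smul_duhamel` expresses the difference of the semigroups through
`A_i J - J B`. For `B = J† A_i J` this operator is independent of `i` and maps into `ker J†`, so the
integrand tends to zero and dominated convergence applies. -/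

theorem IsSelfAdjoint.exp_smul_eq_cfc {𝒜 : Type*} [CStarAlgebra 𝒜] {a : 𝒜} (ha : IsSelfAdjoint a)
    (s : ℝ) : NormedSpace.exp (s • a) = cfc (fun x : ℝ => Real.exp (s * x)) a := by
  rw [← CFC.real_exp_eq_normedSpace_exp ((IsSelfAdjoint.all s).smul ha)]
  exact (cfc_comp_const_mul s Real.exp a).symm

/-! ### Spectral bounds for semigroups of positive operators -/

section Abstract
variable {H H' : Type*} [NormedAddCommGroup H] [InnerProductSpace ℂ H] [CompleteSpace H]
  [NormedAddCommGroup H'] [InnerProductSpace ℂ H'] [CompleteSpace H']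

theorem ContinuousLinearMap.IsPositive.exp_neg_smul_eq_cfc {A : H →L[ℂ] H} (hA : A.IsPositive)
    (s : ℝ) : NormedSpace.exp (-(s : ℂ) • A) = cfc (fun x : ℝ => Real.exp (-s * x)) A := by
  have hsa : IsSelfAdjoint A := hA.isSelfAdjoint
  have e : -(s : ℂ) • A = (-s) • A := by
    rw [← Complex.coe_smul]; simp
  rw [e]
  exact hsa.exp_smul_eq_cfc (-s)

theorem ContinuousLinearMap.IsPositive.norm_exp_neg_smul_le_one {A : H →L[ℂ] H}
    (hA : A.IsPositive) {s : ℝ} (hs : 0 ≤ s) : ‖NormedSpace.exp (-(s : ℂ) • A)‖ ≤ 1 := by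
  rw [hA.exp_neg_smul_eq_cfc]
  refine norm_cfc_le zero_le_one fun x hx => ?_
  have hx0 : 0 ≤ x := spectrum_nonneg_of_nonneg (A.nonneg_iff_isPositive.2 hA) hx
  rw [Real.norm_eq_abs, abs_of_pos (Real.exp_pos _), Real.exp_le_one_iff]
  nlinarith [mul_nonneg hs hx0]

/-- On the spectrum, contained in `[0, ∞)`, one has `x e^{-sx} ≤ 1/s`, because `s x + 1 ≤ e^{sx}`.
-/
theorem ContinuousLinearMap.IsPositive.norm_mul_exp_neg_smul_le {A : H →L[ℂ] H}
    (hA : A.IsPositive) {s : ℝ} (hs : 0 < s) :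
    ‖A * NormedSpace.exp (-(s : ℂ) • A)‖ ≤ 1 / s := by
  have hsa : IsSelfAdjoint A := hA.isSelfAdjoint
  rw [hA.exp_neg_smul_eq_cfc]
  nth_rewrite 1 [← cfc_id' ℝ A]
  rw [← cfc_mul ..]
  refine norm_cfc_le (by positivity) fun x hx => ?_
  have hx0 : 0 ≤ x := spectrum_nonneg_of_nonneg (A.nonneg_iff_isPositive.2 hA) hx
  rw [Real.norm_eq_abs, abs_of_nonneg (by positivity), le_div_iff₀ hs, neg_mul, Real.exp_neg]
  have := Real.add_one_le_exp (s * x)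
  rw [mul_right_comm, ← div_eq_mul_inv, div_le_one (Real.exp_pos _)]
  linarith

theorem ContinuousLinearMap.IsPositive.isSelfAdjoint_exp_neg_smul {A : H →L[ℂ] H}
    (hA : A.IsPositive) (s : ℝ) : IsSelfAdjoint (NormedSpace.exp (-(s : ℂ) • A)) := by
  rw [hA.exp_neg_smul_eq_cfc]
  exact cfc_predicate _ _

theorem exp_neg_add_smul (A : H →L[ℂ] H) (s r : ℝ) :
    NormedSpace.exp (-((s + r : ℝ) : ℂ) • A) =
      NormedSpace.exp (-(s : ℂ) • A) * NormedSpace.exp (-(r : ℂ) • A) := by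
  let _ := NormedAlgebra.restrictScalars ℚ ℂ (H →L[ℂ] H)
  rw [← NormedSpace.exp_add_of_commute ((Commute.refl A).smul_left _ |>.smul_right _), ← add_smul]
  push_cast
  ring_nf

/-- The form bound is tested at `h = e^{-2sA} d`. There `⟨d, h⟩ = ‖e^{-sA} d‖²`, whose square is the
fourth power, while smoothing bounds the form by a quantity that does not see `A`. -/
theorem ContinuousLinearMap.IsPositive.norm_exp_neg_smul_apply_pow_le {A : H →L[ℂ] H}
    (hA : A.IsPositive) {s c : ℝ} (hs : 0 < s) (d : H)
    (hd : ∀ h, c * ‖inner ℂ d h‖ ^ 2 ≤ (inner ℂ (A h) h).re) :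
    c * ‖NormedSpace.exp (-(s : ℂ) • A) d‖ ^ 4 ≤ ‖d‖ ^ 2 / (2 * s) := by
  set e := NormedSpace.exp (-(s : ℂ) • A) with he
  set e2 := NormedSpace.exp (-((s + s : ℝ) : ℂ) • A) with he2
  have h1 : ‖e d‖ ^ 2 = ‖inner ℂ d (e2 d)‖ := by
    rw [he2, exp_neg_add_smul, mul_apply_eq_comp, ← he,
      ← ContinuousLinearMap.adjoint_inner_left]
    have : ContinuousLinearMap.adjoint e = e := hA.isSelfAdjoint_exp_neg_smul s
    rw [this, inner_self_eq_norm_sq_to_K]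
    simp
  have h2 := hd (e2 d)
  rw [← h1] at h2
  have h3 : (inner ℂ (A (e2 d)) (e2 d)).re ≤ ‖d‖ ^ 2 / (2 * s) :=
    calc _ ≤ ‖A (e2 d)‖ * ‖e2 d‖ := re_inner_le_norm (𝕜 := ℂ) _ _
      _ ≤ (1 / (s + s) * ‖d‖) * (1 * ‖d‖) := by
        gcongr
        · exact (A * e2).le_of_opNorm_le (hA.norm_mul_exp_neg_smul_le (by positivity)) d
        · exact e2.le_of_opNorm_le (hA.norm_exp_neg_smul_le_one (by positivity)) d
      _ = _ := by rw [← two_mul]; ring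
  calc _ = c * (‖e d‖ ^ 2) ^ 2 := by ring
    _ ≤ _ := h2.trans h3

/-! ### Differentiation of the semigroup and Duhamel's formula -/

theorem hasDerivAt_exp_neg_smul (A : H →L[ℂ] H) (s : ℝ) :
    HasDerivAt (fun s : ℝ => NormedSpace.exp (-(s : ℂ) • A))
      (-(NormedSpace.exp (-(s : ℂ) • A) * A)) s := by
  have := hasDerivAt_exp_smul_const (𝕂 := ℝ) (-A) s
  have e : ∀ s : ℝ, s • (-A) = -(s : ℂ) • A := fun s => by
    rw [← Complex.coe_smul]; simp
  simpa [e] using this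

/-- Duhamel's formula comparing two semigroups along `J`. -/
theorem exp_neg_smul_duhamel (A : H →L[ℂ] H) (B : H' →L[ℂ] H') (J : H' →L[ℂ] H) (t : ℝ) (g : H') :
    ∫ s in (0 : ℝ)..t, NormedSpace.exp (-((t - s : ℝ) : ℂ) • A)
        ((A ∘L J - J ∘L B) (NormedSpace.exp (-(s : ℂ) • B) g)) =
      J (NormedSpace.exp (-(t : ℂ) • B) g) - NormedSpace.exp (-(t : ℂ) • A) (J g) := by
  have hA : ∀ s : ℝ, HasDerivAt (fun s : ℝ => NormedSpace.exp (-((t - s : ℝ) : ℂ) • A))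
      (NormedSpace.exp (-((t - s : ℝ) : ℂ) • A) * A) s := fun s => by
    have := (hasDerivAt_exp_neg_smul A (t - s)).scomp s ((hasDerivAt_id s).const_sub t)
    exact this.congr_deriv (by simp)
  have hB : ∀ s : ℝ, HasDerivAt (fun s : ℝ => J (NormedSpace.exp (-(s : ℂ) • B) g))
      (J (-(NormedSpace.exp (-(s : ℂ) • B) * B) g)) s := fun s =>
    J.restrictScalars ℝ |>.hasFDerivAt.comp_hasDerivAt s
      (((ContinuousLinearMap.apply ℂ H' g).restrictScalars ℝ).hasFDerivAt.comp_hasDerivAt s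
        (hasDerivAt_exp_neg_smul B s))
  -- Moves `B` to the left of its semigroup, so that the two terms of the product rule combine into
  -- `A J - J B`.
  have hcomm : ∀ s : ℝ, NormedSpace.exp (-(s : ℂ) • B) * B = B * NormedSpace.exp (-(s : ℂ) • B) :=
    fun s => ((Commute.refl B).smul_left _).exp_left
  have key : ∀ s : ℝ, HasDerivAt (fun s : ℝ => NormedSpace.exp (-((t - s : ℝ) : ℂ) • A)
      (J (NormedSpace.exp (-(s : ℂ) • B) g)))
      (NormedSpace.exp (-((t - s : ℝ) : ℂ) • A)
        ((A ∘L J - J ∘L B) (NormedSpace.exp (-(s : ℂ) • B) g))) s := fun s => by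
    have := ((ContinuousLinearMap.restrictScalarsL ℂ H H ℝ ℝ).hasFDerivAt.comp_hasDerivAt s
      (hA s)).clm_apply (hB s)
    refine this.congr_deriv ?_
    simp only [hcomm]
    simp [sub_eq_add_neg]
  rw [intervalIntegral.integral_eq_sub_of_hasDerivAt (fun s _ => key s)]
  · simp
  · refine Continuous.intervalIntegrable ?_ _ _
    have cA : Continuous fun s : ℝ => NormedSpace.exp (-((t - s : ℝ) : ℂ) • A) :=
      continuous_iff_continuousAt.2 fun s => (hA s).continuousAt
    have cB : Continuous fun s : ℝ => NormedSpace.exp (-(s : ℂ) • B) :=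
      continuous_iff_continuousAt.2 fun s => (hasDerivAt_exp_neg_smul B s).continuousAt
    exact cA.clm_apply ((A ∘L J - J ∘L B).continuous.comp (cB.clm_apply continuous_const))

theorem continuous_exp_neg_smul (A : H →L[ℂ] H) :
    Continuous fun s : ℝ => NormedSpace.exp (-(s : ℂ) • A) :=
  continuous_iff_continuousAt.2 fun s => (hasDerivAt_exp_neg_smul A s).continuousAt

/-! ### Strong convergence when the forms blow up -/

variable {ι : Type*} {l : Filter ι}

/-- On `D` the fourth-power estimate forces decay; linearity gives the span, and contractivity,
uniform in `i`, gives its closure. -/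
theorem tendsto_exp_neg_smul_zero {A : ι → H →L[ℂ] H} (hA : ∀ i, (A i).IsPositive) {D : Set H}
    (hD : ∀ d ∈ D, ∃ c : ι → ℝ, Tendsto c l atTop ∧
      ∀ i h, c i * ‖inner ℂ d h‖ ^ 2 ≤ (inner ℂ (A i h) h).re)
    {s : ℝ} (hs : 0 < s) {g : H} (hg : g ∈ (Submodule.span ℂ D).topologicalClosure) :
    Tendsto (fun i => NormedSpace.exp (-(s : ℂ) • A i) g) l (𝓝 0) := by
  have hspan : ∀ g ∈ Submodule.span ℂ D,
      Tendsto (fun i => NormedSpace.exp (-(s : ℂ) • A i) g) l (𝓝 0) := by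
    intro g hg
    induction hg using Submodule.span_induction with
    | mem d hd =>
      obtain ⟨c, hc, h⟩ := hD d hd
      have h4 : Tendsto (fun i => ‖NormedSpace.exp (-(s : ℂ) • A i) d‖ ^ 4) l (𝓝 0) := by
        refine tendsto_of_tendsto_of_tendsto_of_le_of_le' tendsto_const_nhds
          ((tendsto_const_nhds (x := ‖d‖ ^ 2 / (2 * s))).div_atTop hc)
          (Eventually.of_forall fun i => by positivity) ?_
        filter_upwards [hc.eventually_gt_atTop 0] with i hi
        rw [le_div_iff₀' hi]
        exact (hA i).norm_exp_neg_smul_apply_pow_le hs d (h i)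
      rw [tendsto_zero_iff_norm_tendsto_zero]
      -- The fourth root is taken as two square roots.
      have := h4.sqrt.sqrt
      have e : ∀ x : ℝ, 0 ≤ x → √√(x ^ 4) = x := fun x hx => by
        rw [show x ^ 4 = (x ^ 2) ^ 2 by ring, Real.sqrt_sq (by positivity), Real.sqrt_sq hx]
      simpa [e] using this
    | zero => simpa using tendsto_const_nhds
    | add x y _ _ hx hy => simpa using hx.add hy
    | smul a x _ hx => simpa using hx.const_smul a
  rw [Metric.tendsto_nhds]
  intro ε hε
  obtain ⟨g', hg', hgg⟩ := Metric.mem_closure_iff.1 hg (ε / 2) (by positivity)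
  filter_upwards [Metric.tendsto_nhds.1 (hspan g' hg') (ε / 2) (by positivity)] with i hi
  rw [dist_zero_right] at hi ⊢
  have h1 : ‖NormedSpace.exp (-(s : ℂ) • A i) (g - g')‖ ≤ 1 * ‖g - g'‖ :=
    ContinuousLinearMap.le_of_opNorm_le _ ((hA i).norm_exp_neg_smul_le_one hs.le) _
  rw [← dist_eq_norm, map_sub] at h1
  have := norm_add_le (NormedSpace.exp (-(s : ℂ) • A i) g - NormedSpace.exp (-(s : ℂ) • A i) g')
    (NormedSpace.exp (-(s : ℂ) • A i) g')
  rw [sub_add_cancel] at this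
  linarith

/-- If the forms of the positive operators `A i` blow up on a set `D` of vectors with
`Dᗮ ⊆ range J`, while `A i ∘ J` does not depend on `i`, then the semigroups of the `A i` converge
strongly to the semigroup of the compression `J† A J`. -/
theorem tendsto_exp_neg_smul_of_blowup [l.IsCountablyGenerated] {A : ι → H →L[ℂ] H}
    (hA : ∀ i, (A i).IsPositive) {D : Set H}
    (hD : ∀ d ∈ D, ∃ c : ι → ℝ, Tendsto c l atTop ∧
      ∀ i h, c i * ‖inner ℂ d h‖ ^ 2 ≤ (inner ℂ (A i h) h).re)
    {J T : H' →L[ℂ] H} (hJ : ContinuousLinearMap.adjoint J ∘L J = ContinuousLinearMap.id ℂ H')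
    (hDJ : ∀ h, (∀ d ∈ D, inner ℂ d h = 0) → ∃ g, J g = h)
    (hT : ∀ i, A i ∘L J = T) {B : H' →L[ℂ] H'} (hB : ContinuousLinearMap.adjoint J ∘L T = B)
    {t : ℝ} (ht : 0 < t) (f : H) :
    Tendsto (fun i => NormedSpace.exp (-(t : ℂ) • A i) f) l
      (𝓝 (J (NormedSpace.exp (-(t : ℂ) • B) (ContinuousLinearMap.adjoint J f)))) := by
  have hker : ∀ g, ContinuousLinearMap.adjoint J g = 0 →
      g ∈ (Submodule.span ℂ D).topologicalClosure := by
    -- The closed span of `D` is its double orthogonal complement. A vector of `ker J†` is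
    -- orthogonal to the range of `J`, hence to `Dᗮ`.
    intro g hg
    rw [← Submodule.orthogonal_orthogonal_eq_closure, Submodule.mem_orthogonal]
    intro h hh
    obtain ⟨k, rfl⟩ := hDJ h fun d hd =>
      (Submodule.mem_orthogonal _ _).1 hh d (Submodule.subset_span hd)
    rw [← ContinuousLinearMap.adjoint_inner_right, hg, inner_zero_right]
  have hJJ : ∀ g, ContinuousLinearMap.adjoint J (J g) = g := fun g => DFunLike.congr_fun hJ g
  -- With `B = J† T` and `J† J = 1`, the two terms of `J† (T - J B)` cancel.
  have hR : ∀ g, ContinuousLinearMap.adjoint J ((T - J ∘L B) g) = 0 := fun g => by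
    simp [hJJ, ← hB]
  have hrange : ∀ g, Tendsto (fun i => NormedSpace.exp (-(t : ℂ) • A i) (J g)) l
      (𝓝 (J (NormedSpace.exp (-(t : ℂ) • B) g))) := by
    intro g
    have hd := fun i => exp_neg_smul_duhamel (A i) B J t g
    simp only [hT] at hd
    have hlim : Tendsto (fun i => ∫ s in (0 : ℝ)..t, NormedSpace.exp (-((t - s : ℝ) : ℂ) • A i)
        ((T - J ∘L B) (NormedSpace.exp (-(s : ℂ) • B) g))) l
        (𝓝 (∫ s in (0 : ℝ)..t, (0 : H))) := by
      have cR : Continuous fun s : ℝ => (T - J ∘L B) (NormedSpace.exp (-(s : ℂ) • B) g) :=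
        (T - J ∘L B).continuous.comp ((continuous_exp_neg_smul B).clm_apply continuous_const)
      refine intervalIntegral.tendsto_integral_filter_of_dominated_convergence
        (fun s => ‖(T - J ∘L B) (NormedSpace.exp (-(s : ℂ) • B) g)‖) ?_ ?_ ?_ ?_
      · refine Eventually.of_forall fun i => Continuous.aestronglyMeasurable ?_
        exact ((continuous_exp_neg_smul (A i)).comp (continuous_const.sub continuous_id)).clm_apply
          cR
      · refine Eventually.of_forall fun i => Eventually.of_forall fun s hs => ?_
        rw [Set.uIoc_of_le ht.le] at hs
        exact (ContinuousLinearMap.le_of_opNorm_le _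
          ((hA i).norm_exp_neg_smul_le_one (sub_nonneg.2 hs.2)) _).trans_eq (one_mul _)
      · exact cR.norm.intervalIntegrable _ _
      · have : ∀ᵐ s : ℝ, s ≠ t := by simp [ae_iff]
        filter_upwards [this] with s hst hs
        rw [Set.uIoc_of_le ht.le] at hs
        exact tendsto_exp_neg_smul_zero hA hD (sub_pos.2 (lt_of_le_of_ne hs.2 hst))
          (hker _ (hR _))
    simp only [hd, intervalIntegral.integral_zero] at hlim
    simpa using (tendsto_const_nhds (x := J (NormedSpace.exp (-(t : ℂ) • B) g))).sub hlim
  have h0 := tendsto_exp_neg_smul_zero hA hD ht (g := f - J (ContinuousLinearMap.adjoint J f))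
    (hker _ (by rw [map_sub, hJJ, sub_self]))
  simpa using h0.add (hrange (ContinuousLinearMap.adjoint J f))

end Abstract

/-! ### The Dirichlet form of the graph Laplacian -/

namespace WeightedGraph
variable {V : Type*}

theorem hasSum_inner (G : WeightedGraph V) (f g : G.ell2) :
    HasSum (fun v => (G.m v : ℂ) * (conj (f v) * g v)) (inner ℂ f g) := by
  let _ : MeasurableSpace V := ⊤
  have hi : Integrable (fun v => inner ℂ (f v) (g v)) (massMeasure G.m) :=
    L2.integrable_inner f g
  rw [L2.inner_def]
  refine (hasSum_integral_measure hi).congr_fun fun v => ?_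
  rw [integral_smul_measure, integral_dirac, ENNReal.toReal_ofReal (G.m_pos v).le]
  simp [mul_comm]

theorem summable_mass_mul_norm_sq (G : WeightedGraph V) (f : G.ell2) :
    Summable fun v => G.m v * ‖f v‖ ^ 2 := by
  have := (G.hasSum_inner f f).summable.norm
  refine this.congr fun v => ?_
  simp [abs_of_pos (G.m_pos v), sq]

/-- The row sums of the weights are at most `C * m x`, so the series is dominated by the `ℓ²` norm.
It majorizes the double series rearranged below. -/
theorem summable_weight_mul_norm_sq (G : WeightedGraph V) (hG : G.BoundedDegrees) (f : G.ell2) :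
    Summable fun p : V × V => G.a p.1 p.2 * ‖f p.1‖ ^ 2 := by
  obtain ⟨C, -, h⟩ := hG
  rw [summable_prod_of_nonneg fun p => mul_nonneg (G.a_nonneg _ _) (by positivity)]
  refine ⟨fun x => ?_, ?_⟩
  · exact (h x).1.1.mul_right (‖f x‖ ^ 2)
  refine Summable.of_nonneg_of_le (fun x => tsum_nonneg fun y =>
    mul_nonneg (G.a_nonneg x y) (by positivity)) (fun x => ?_)
    ((G.summable_mass_mul_norm_sq f).mul_left C)
  simp only [tsum_mul_right]
  rw [← mul_assoc]
  gcongr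
  exact (h x).1.2

theorem IsUndirected.symm {G : WeightedGraph V} (h : G.IsUndirected) (v w : V) :
    G.a v w = G.a w v :=
  congrFun (congrFun (congrArg WeightedGraph.a h) v) w

theorem summable_weight_mul_conj (G : WeightedGraph V) (hG : G.BoundedDegrees) (f g : G.ell2) :
    Summable fun p : V × V => (G.a p.1 p.2 : ℂ) * (conj (f p.1) * g p.1) := by
  refine Summable.of_norm_bounded
    ((G.summable_weight_mul_norm_sq hG f).add (G.summable_weight_mul_norm_sq hG g)) fun p => ?_
  rw [norm_mul, norm_mul, Complex.norm_conj, Complex.norm_of_nonneg (G.a_nonneg _ _), ← mul_add]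
  gcongr
  · exact G.a_nonneg _ _
  · nlinarith [sq_nonneg (‖f p.1‖ - ‖g p.1‖), sq_nonneg ‖f p.1‖, sq_nonneg ‖g p.1‖]

theorem summable_weight_mul_conj_offDiag (G : WeightedGraph V) (hG : G.BoundedDegrees)
    (ha : ∀ v w, G.a v w = G.a w v) (f g : G.ell2) :
    Summable fun p : V × V => (G.a p.1 p.2 : ℂ) * (conj (f p.1) * g p.2) := by
  have hswap : Summable fun p : V × V => G.a p.1 p.2 * ‖g p.2‖ ^ 2 :=
    ((Equiv.prodComm V V).summable_iff.2 (G.summable_weight_mul_norm_sq hG g)).congr fun p => by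
      simp [ha p.1 p.2]
  refine Summable.of_norm_bounded ((G.summable_weight_mul_norm_sq hG f).add hswap) fun p => ?_
  rw [norm_mul, norm_mul, Complex.norm_conj, Complex.norm_of_nonneg (G.a_nonneg _ _), ← mul_add]
  gcongr
  · exact G.a_nonneg _ _
  · nlinarith [sq_nonneg (‖f p.1‖ - ‖g p.2‖), sq_nonneg ‖f p.1‖, sq_nonneg ‖g p.2‖]

theorem hasSum_laplacian (G : WeightedGraph V) (hG : G.BoundedDegrees) (f : G.ell2) (x : V) :
    HasSum (fun y => (G.a x y : ℂ) * (f x - f y)) ((G.m x : ℂ) * G.laplacian hG f x) := by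
  have hdeg : HasSum (fun y => (G.a x y : ℂ)) (G.inDegree x : ℂ) := by
    obtain ⟨C, -, h⟩ := hG
    exact Complex.hasSum_ofReal.2 (h x).1.1.hasSum
  have hm : (G.m x : ℂ) ≠ 0 := by exact_mod_cast (G.m_pos x).ne'
  have := (hdeg.mul_right (f x)).sub (hG.summable f x).hasSum
  rw [laplacian_apply, ← mul_assoc, mul_one_div_cancel hm, one_mul]
  exact this.congr_fun fun y => mul_sub _ _ _

/-- The Laplacian of an undirected graph is given by its Dirichlet form. -/
theorem hasSum_inner_laplacian (G : WeightedGraph V) (hG : G.BoundedDegrees)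
    (ha : ∀ v w, G.a v w = G.a w v) (f g : G.ell2) :
    HasSum (fun p : V × V => (G.a p.1 p.2 : ℂ) * (conj (f p.1 - f p.2) * (g p.1 - g p.2)))
      (2 * inner ℂ f (G.laplacian hG g)) := by
  have hsub := ((G.summable_weight_mul_conj hG f g).sub
    (G.summable_weight_mul_conj_offDiag hG ha f g)).hasSum
  have hrow : ∀ x, HasSum (fun y => (G.a x y : ℂ) * (conj (f x) * g x) -
      (G.a x y : ℂ) * (conj (f x) * g y)) ((G.m x : ℂ) * (conj (f x) * G.laplacian hG g x)) := by
    intro x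
    rw [mul_left_comm]
    exact ((G.hasSum_laplacian hG g x).mul_left (conj (f x))).congr_fun fun y => by ring
  -- Summing by rows identifies the unsymmetrized double series with `⟨f, L g⟩`.
  have huniq := (hsub.prod_fiberwise hrow).unique (G.hasSum_inner f (G.laplacian hG g))
  rw [huniq] at hsub
  rw [two_mul]
  -- Adding the series with `p.1` and `p.2` exchanged completes the product of differences; this is
  -- where symmetry of the weights enters.
  refine (hsub.add ((Equiv.prodComm V V).hasSum_iff.2 hsub)).congr_fun fun p => ?_
  simp only [Function.comp_apply, Equiv.prodComm_apply, Prod.fst_swap, Prod.snd_swap, map_sub]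
  rw [ha p.2 p.1]
  ring

theorem hasSum_energy (G : WeightedGraph V) (hG : G.BoundedDegrees)
    (ha : ∀ v w, G.a v w = G.a w v) (f : G.ell2) :
    HasSum (fun p : V × V => G.a p.1 p.2 * ‖f p.1 - f p.2‖ ^ 2)
      (2 * (inner ℂ (G.laplacian hG f) f).re) := by
  have h := Complex.hasSum_re (G.hasSum_inner_laplacian hG ha f f)
  have e : ∀ p : V × V, ((G.a p.1 p.2 : ℂ) * (conj (f p.1 - f p.2) * (f p.1 - f p.2))).re =
      G.a p.1 p.2 * ‖f p.1 - f p.2‖ ^ 2 := fun p => by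
    rw [← Complex.normSq_eq_conj_mul_self, ← Complex.ofReal_mul, Complex.ofReal_re,
      Complex.normSq_eq_norm_sq]
  simp only [e] at h
  rw [← inner_conj_symm, Complex.conj_re]
  simpa using h

theorem isPositive_laplacian (G : WeightedGraph V) (hG : G.BoundedDegrees)
    (ha : ∀ v w, G.a v w = G.a w v) : (G.laplacian hG).IsPositive := by
  refine ContinuousLinearMap.isPositive_def.2 ⟨fun f g => ?_, fun f => ?_⟩
  · have h1 := Complex.hasSum_conj'.2 (G.hasSum_inner_laplacian hG ha g f)
    have h2 := G.hasSum_inner_laplacian hG ha f g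
    have := h1.unique (h2.congr_fun fun p => by
      simp only [map_mul, map_sub, Complex.conj_ofReal, Complex.conj_conj]; ring)
    rw [map_mul, inner_conj_symm, Complex.conj_ofNat] at this
    exact mul_left_cancel₀ two_ne_zero this
  · have := (G.hasSum_energy hG ha f).nonneg fun p => mul_nonneg (G.a_nonneg _ _) (by positivity)
    exact nonneg_of_mul_nonneg_right this two_pos

/-- A single term of a nonnegative series is kept; the factor `1/2` appears because the sum over
ordered pairs is twice the form. -/
theorem weight_mul_norm_sq_le (G : WeightedGraph V) (hG : G.BoundedDegrees)
    (ha : ∀ v w, G.a v w = G.a w v) (f : G.ell2) (x y : V) :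
    G.a x y / 2 * ‖f x - f y‖ ^ 2 ≤ (inner ℂ (G.laplacian hG f) f).re := by
  have := le_hasSum (G.hasSum_energy hG ha f) (x, y) fun p _ =>
    mul_nonneg (G.a_nonneg p.1 p.2) (by positivity)
  dsimp only at this
  linarith

/-! ### Interpolation, projection and the reduced Laplacian -/

namespace Clusters
variable {G : WeightedGraph V} {I : Type*} (K : G.Clusters I)

theorem adjoint_interpolation : ContinuousLinearMap.adjoint K.interpolation = K.projection := by
  ext1 f
  refine ext_ell2 fun C => ?_
  rw [adjoint_apply, projection_apply]

theorem projection_comp_interpolation :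
    K.projection ∘L K.interpolation = ContinuousLinearMap.id ℂ K.reduced.ell2 := by
  rw [← adjoint_interpolation]
  refine (ContinuousLinearMap.norm_map_iff_adjoint_comp_self K.interpolation).1 fun g => ?_
  let _ : MeasurableSpace V := ⊤
  let _ : MeasurableSpace K.Component := ⊤
  exact Lp.norm_compMeasurePreserving g K.measurePreserving

theorem component_eq_of_mem {v w : V} (h : (v, w) ∈ K.totalEdges) :
    K.component v = K.component w :=
  Quotient.sound (Relation.ReflTransGen.single h)

/-- Equality along cluster edges propagates along paths, so `f` descends to the components. The
descended function is square integrable since the reduced mass is the push-forward measure. -/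
theorem exists_interpolation_eq (f : G.ell2) (hf : ∀ v w, (v, w) ∈ K.totalEdges → f v = f w) :
    ∃ g, K.interpolation g = f := by
  have hc : ∀ v w, K.component v = K.component w → f v = f w := by
    intro v w h
    have : Sees K.totalEdges v w := Quotient.exact h
    induction this with
    | refl => rfl
    | tail _ hbc ih => exact (ih (Quotient.sound ‹_›)).trans (hf _ _ hbc)
  let g : K.Component → ℂ := Quotient.lift f fun v w h => hc v w (Quotient.sound h)
  have hg : @MemLp K.Component ℂ ⊤ _ _ g 2 (massMeasure K.reduced.m) := by
    let _ : MeasurableSpace V := ⊤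
    let _ : MeasurableSpace K.Component := ⊤
    rw [← K.measurePreserving.map_eq]
    exact (memLp_map_measure_iff measurable_from_top.aestronglyMeasurable
      measurable_from_top.aemeasurable).2 (Lp.memLp f)
  refine ⟨hg.toLp g, ext_ell2 fun v => ?_⟩
  rw [interpolation_apply]
  exact toLp_apply K.reduced hg _

theorem reduced_symm (ha : ∀ v w, G.a v w = G.a w v) (C D : K.Component) :
    K.reduced.a C D = K.reduced.a D C := by
  change aggregate _ _ _ _ = aggregate _ _ _ _
  rw [aggregate_swap]
  congr 1
  ext v w
  exact ha w v

/-- Without it the `tsum` in `aggregate` could be the default value `0`. It is the energy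
summability applied to `χ_C`, which lies in `ℓ²` because components have finite mass. -/
theorem summable_aggregate (hG : G.BoundedDegrees) (C D : K.Component) :
    Summable fun p : {v // K.component v = C} × {w // K.component w = D} => G.a p.1 p.2 := by
  have hinj : Function.Injective
      fun p : {v // K.component v = C} × {w // K.component w = D} => ((p.1 : V), (p.2 : V)) :=
    Subtype.val_injective.prodMap Subtype.val_injective
  refine ((G.summable_weight_mul_norm_sq hG (K.indicator C)).comp_injective hinj).congr fun p => ?_
  simp [indicator_apply, p.1.2]

/-- Both sides have the same Dirichlet form: interpolated functions are constant on components, so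
grouping the pairs of vertices by their components aggregates the weights. -/
theorem projection_laplacian_interpolation (hG : G.BoundedDegrees)
    (ha : ∀ v w, G.a v w = G.a w v) :
    K.projection ∘L (G.laplacian hG ∘L K.interpolation) =
      K.reduced.laplacian (K.reduced_boundedDegrees hG) := by
  ext1 g
  refine ext_inner_left ℂ fun h => ?_
  rw [ContinuousLinearMap.comp_apply, ContinuousLinearMap.comp_apply, ← adjoint_interpolation,
    ContinuousLinearMap.adjoint_inner_right]
  refine mul_left_cancel₀ (two_ne_zero (α := ℂ)) ?_
  have h1 := G.hasSum_inner_laplacian hG ha (K.interpolation h) (K.interpolation g)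
  have h2 := K.reduced.hasSum_inner_laplacian (K.reduced_boundedDegrees hG) (K.reduced_symm ha) h g
  let q : V × V → K.Component × K.Component := Prod.map K.component K.component
  have h3 := (Equiv.sigmaFiberEquiv q).hasSum_iff.2 h1
  refine (h3.sigma fun P => ?_).unique h2
  let e : {v // K.component v = P.1} × {w // K.component w = P.2} ≃ {p // q p = P} :=
    { toFun x := ⟨(x.1, x.2), Prod.ext x.1.2 x.2.2⟩
      invFun y := (⟨y.1.1, congrArg Prod.fst y.2⟩, ⟨y.1.2, congrArg Prod.snd y.2⟩) }
  have hs := (Complex.hasSum_ofReal.2 (K.summable_aggregate hG P.1 P.2).hasSum).mul_right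
    (conj (h P.1 - h P.2) * (g P.1 - g P.2))
  refine e.hasSum_iff.1 (hs.congr_fun fun x => ?_)
  obtain ⟨⟨v, hv⟩, ⟨w, hw⟩⟩ := x
  simp [e, Equiv.sigmaFiberEquiv, interpolation_apply, hv, hw]

/-! ### Independence of the connectivity parameter on the range of interpolation -/

namespace ConnectivityFamily
variable {K} (F : K.ConnectivityFamily)

theorem weight_eq {v w : V} (h : (v, w) ∉ K.totalEdges) (β : ℝ≥0) : F.a β v w = G.a v w := by
  by_cases hE : (v, w) ∈ G.E
  -- `a_background` compares only with a strictly smaller parameter, so `β = 0` is treated through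
  -- `a_zero`.
  · rcases eq_or_lt_of_le (zero_le (a := β)) with rfl | hβ
    · exact F.a_zero v w
    · exact F.a_background 0 β hβ v w ⟨hE, h⟩
  · have h1 := mt (F.a_pos_iff β v w).1 hE
    have h2 := mt (G.a_pos_iff v w).1 hE
    rw [le_antisymm (not_lt.1 h1) (F.a_nonneg β v w), le_antisymm (not_lt.1 h2) (G.a_nonneg v w)]

/-- Only weights on cluster edges vary with `β`, and these multiply differences of an interpolated
function inside one component, which vanish. -/
theorem laplacian_comp_interpolation (hG : G.BoundedDegrees) (β : ℝ≥0)
    (hF : (F.graph β).BoundedDegrees) :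
    (F.graph β).laplacian hF ∘L K.interpolation = G.laplacian hG ∘L K.interpolation := by
  ext1 g
  refine ext_ell2 (G := G) fun x => ?_
  have hm : (G.m x : ℂ) ≠ 0 := by exact_mod_cast (G.m_pos x).ne'
  refine mul_left_cancel₀ hm ?_
  refine ((F.graph β).hasSum_laplacian hF (K.interpolation g) x).unique
    ((G.hasSum_laplacian hG (K.interpolation g) x).congr_fun fun y => ?_)
  by_cases h : (x, y) ∈ K.totalEdges
  · simp [interpolation_apply, K.component_eq_of_mem h]
  · exact congrArg (fun r : ℝ => (r : ℂ) * _) (F.weight_eq h β)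

end ConnectivityFamily
end Clusters
end WeightedGraph

/-! ### Point evaluations and the main theorem -/

namespace WeightedGraph

/-- The representing vector is the point indicator divided by the mass. -/
theorem exists_inner_eq_apply {V : Type*} (G : WeightedGraph V) (v : V) :
    ∃ d : G.ell2, ∀ h : G.ell2, inner ℂ d h = h v := by
  classical
  have hm : (G.m v : ℂ) ≠ 0 := by exact_mod_cast (G.m_pos v).ne'
  have hd : @MemLp V ℂ ⊤ _ _ (Pi.single v (1 / (G.m v : ℂ))) 2 (massMeasure G.m) := by
    rw [memLp_massMeasure_iff, tsum_eq_single v fun w hw => by simp [hw]]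
    exact ENNReal.mul_ne_top ENNReal.ofReal_ne_top (ENNReal.pow_ne_top enorm_ne_top)
  refine ⟨hd.toLp _, fun h => (G.hasSum_inner _ h).unique ?_⟩
  simp only [toLp_apply]
  convert hasSum_single v fun w hw => ?_ using 1
  · simp [hm]
  · simp [hw]

end WeightedGraph

theorem mainTheorem9 {V : Type*} [Countable V] (G : WeightedGraph V)
    (hG_loc : G.LocallyFinite) (hG_und : G.IsUndirected) (hG_bdd : G.BoundedDegrees)
    {I : Type*} [Countable I] (K : G.Clusters I) (F : K.ConnectivityFamily)
    (hF_und : ∀ β, (F.graph β).IsUndirected) (hF_bdd : ∀ β, (F.graph β).BoundedDegrees)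
    (t : ℝ) (ht : 0 < t) (f : G.ell2) :
    Tendsto (fun β : ℝ≥0 => (F.graph β).heatSemigroup (hF_bdd β) t f) atTop
      (𝓝 (K.interpolation
        (K.reduced.heatSemigroup (K.reduced_boundedDegrees hG_bdd) t (K.projection f)))) := by
  rw [← K.adjoint_interpolation]
  choose δ hδ using G.exists_inner_eq_apply
  -- Pairing with `δ v - δ w` gives `h v - h w`, so `Dᗮ` consists of the functions constant along
  -- cluster edges.
  refine tendsto_exp_neg_smul_of_blowup (H := G.ell2)
    (A := fun β : ℝ≥0 => (F.graph β).laplacian (hF_bdd β))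
    (D := {d | ∃ v w, (v, w) ∈ K.totalEdges ∧ d = δ v - δ w})
    (T := G.laplacian hG_bdd ∘L K.interpolation)
    (fun β => (F.graph β).isPositive_laplacian (hF_bdd β) (hF_und β).symm) ?_ ?_ ?_
    (fun β => F.laplacian_comp_interpolation hG_bdd β (hF_bdd β)) ?_ ht f
  · rintro _ ⟨v, w, hvw, rfl⟩
    refine ⟨fun β => F.a β v w / 2, (F.a_tendsto v w hvw).atTop_div_const two_pos, fun β h => ?_⟩
    rw [inner_sub_left, hδ, hδ]
    exact (F.graph β).weight_mul_norm_sq_le (hF_bdd β) (hF_und β).symm h v w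
  · rw [K.adjoint_interpolation, K.projection_comp_interpolation]
  · refine fun h hh => K.exists_interpolation_eq h fun v w hvw => ?_
    have := hh _ ⟨v, w, hvw, rfl⟩
    rwa [inner_sub_left, hδ, hδ, sub_eq_zero] at this
  · rw [K.adjoint_interpolation, K.projection_laplacian_interpolation hG_bdd hG_und.symm]
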